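/- Let $\mathcal M=(S,A,\to,\Rightarrow,s_0)$ be a finite Markov automaton: $S$ is a nonempty finite set of states, $s_0 \in S$ the initial state, $A$ a finite set of actions, ${\to}\subseteq S\times A\times \mathrm{Distr}(S)$ a finite probabilistic transition relation, ${\Rightarrow}\subseteq S\times\mathbb R_{>0}\times S$ a finite Markovian transition relation. All actions are internal, so by maximal progress a state with an outgoing probabilistic transition never performs a Markovian one. Let $PS$ be the set of states with an outgoing probabilistic transition, $MS$ the set of states that have no outgoing probabilistic transition but an outgoing Markovian one, and assume that $S=PS\cup MS$ (no deadlocks). Let $R(s,s')=\sum\{\lambda\mid s\stackrel{\lambda}{\Rightarrow}s'\}$, $E(s)=\sum_{s'}R(s,s')$ and $P(s,s')=R(s,s')/E(s)$. A general measurable policy $D$ assigns, measurably, to each finite path (including its residence times) that ends in a state $s\in PS$ a probability distribution over the probabilistic transitions $s\xrightarrow{\alpha}\mu$ enabled in $s$. Together with a first state $s$ it induces a probability measure $\Pr_{s,D}$ on infinite paths $s_0\xrightarrow{\sigma_0,\mu_0,t_0}s_1\xrightarrow{\sigma_1,\mu_1,t_1}\cdots$: in a state of $PS$ a transition is chosen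 according to $D$, the residence time is $0$ and the next state is drawn from the chosen $\mu$; in a state $s\in MS$ the residence time is exponentially distributed with rate $E(s)$ and, independently, the next state is drawn from $P(s,\cdot)$. For $G\subseteq S$ let $V_G(\pi)\in[0,\infty]$ be the time that elapses along $\pi$ before a state of $G$ is first visited ($\infty$ if there is none), and let $$eT^{\min}(s,\Diamond G)=\inf_D\int V_G\,d\Pr\nolimits_{s,D}\in[0,\infty],$$ where $D$ ranges over all general measurable policies. Then $eT^{\min}(\cdot,\Diamond G)\colon S\to[0,\infty]$ is a fixpoint of the Bellman operator $L$ on functions $v\colon S\to[0,\infty]$ (with $0\cdot\infty=0$) given by $$[L(v)](s)=\begin{cases}\dfrac1{E(s)}+\displaystyle\sum_{s'\in S}P(s,s')\,v(s') & \text{if } s\in MS\setminus G,\\[2mm] \displaystyle\min_{s\xrightarrow{\alpha}\mu}\ \sum_{s'\in S}\mu(s')\,v(s') & \text{if } s\in PS\setminus G,\\[2mm] 0 & \text{if } s\in G.\end{cases}$$ (If each enabled action $\alpha\in Act(s)$ determines a unique distribution $\mu^s_\alpha$, the minimum is the one over $\alpha\in Act(s)$.) -/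

import Mathlib

open MeasureTheory ProbabilityTheory
open scoped NNReal ENNReal

noncomputable section

/-- A finite Markov automaton with states `S` and universe of actions `Act`: a finite set of
actions, a finite probabilistic transition relation `prob ⊆ S × A × Distr(S)`, a finite Markovian
transition relation `markov ⊆ S × ℝ_{>0} × S`, and an initial state. -/
structure MarkovAutomaton (S Act : Type*) [Fintype S] where
  actions : Finset Act
  prob : Finset (S × Act × PMF S)
  markov : Finset (S × ℝ≥0 × S)
  init : S
  action_mem : ∀ tr ∈ prob, tr.2.1 ∈ actions
  rate_pos : ∀ tr ∈ markov, 0 < tr.2.1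

namespace MarkovAutomaton

variable {S Act : Type*} [Fintype S]

/-- The probabilistic transitions, as a (finite) type. -/
abbrev Trans (M : MarkovAutomaton S Act) : Type _ := {tr : S × Act × PMF S // tr ∈ M.prob}

/-- The source `s` of a probabilistic transition `(s, α, μ)`. -/
def Trans.source {M : MarkovAutomaton S Act} (tr : M.Trans) : S := tr.1.1

/-- The distribution `μ` of a probabilistic transition `(s, α, μ)`. -/
def Trans.dist {M : MarkovAutomaton S Act} (tr : M.Trans) : PMF S := tr.1.2.2

open Classical in
/-- The probabilistic transitions enabled in `s`. -/
def enabled (M : MarkovAutomaton S Act) (s : S) : Finset M.Trans :=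
  Finset.univ.filter (fun tr => tr.source = s)

/-- The probabilistic states: those with an outgoing probabilistic transition. All actions are
internal, so by maximal progress such a state never performs a Markovian transition. -/
def PS (M : MarkovAutomaton S Act) : Set S := {s | (M.enabled s).Nonempty}

/-- The Markovian states: after maximal progress, all their transitions are Markovian
(and there is at least one). -/
def MS (M : MarkovAutomaton S Act) : Set S := {s | s ∉ M.PS ∧ ∃ tr ∈ M.markov, tr.1 = s}

/-- Every state has an outgoing transition. -/
def DeadlockFree (M : MarkovAutomaton S Act) : Prop := ∀ s, s ∈ M.PS ∨ s ∈ M.MS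

open Classical in
/-- The total rate `R(s, s')` from `s` to `s'`. -/
def R (M : MarkovAutomaton S Act) (s s' : S) : ℝ≥0 :=
  ∑ tr ∈ M.markov.filter (fun tr => tr.1 = s ∧ tr.2.2 = s'), tr.2.1

/-- The exit rate `E(s)`. -/
def E (M : MarkovAutomaton S Act) (s : S) : ℝ≥0 := ∑ s', M.R s s'

/-- The branching probability `P(s, s') = R(s, s') / E(s)` of a Markovian state. -/
def P (M : MarkovAutomaton S Act) (s s' : S) : ℝ≥0 := M.R s s' / M.E s

lemma E_pos (M : MarkovAutomaton S Act) {s : S} (hs : s ∈ M.MS) : 0 < M.E s := by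
  classical
  obtain ⟨-, tr, htr, rfl⟩ := hs
  refine lt_of_lt_of_le (M.rate_pos tr htr) ?_
  calc tr.2.1 ≤ M.R tr.1 tr.2.2 := by
        unfold R
        exact Finset.single_le_sum (f := fun tr : S × ℝ≥0 × S => tr.2.1)
          (fun _ _ => zero_le) (by simp [htr])
    _ ≤ M.E tr.1 := Finset.single_le_sum (f := fun s' => M.R tr.1 s')
          (fun _ _ => zero_le) (Finset.mem_univ _)

/-! ### Paths -/

/-- The label `σ, μ` of a step: either a probabilistic transition, or `none` for `⊥`, a Markovian
step (whose distribution is `P(s, ·)`). -/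
def Label (M : MarkovAutomaton S Act) : Type _ := Option M.Trans

instance (M : MarkovAutomaton S Act) : MeasurableSpace M.Label := ⊤

/-- A step `(σ_i, μ_i), t_i, s_{i+1}` of a path: its label, the residence time in the state that
is left, and the state that is entered. -/
abbrev Step (M : MarkovAutomaton S Act) : Type _ := M.Label × ℝ≥0 × S

/-- Finite paths with `n` steps: a first state and `n` steps. -/
abbrev FinPath (M : MarkovAutomaton S Act) (n : ℕ) : Type _ := S × (Fin n → M.Step)

/-- Infinite paths: a first state and a sequence of steps. -/
abbrev Path (M : MarkovAutomaton S Act) : Type _ := S × (ℕ → M.Step)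

/-- The last state of a finite path. -/
def FinPath.last {M : MarkovAutomaton S Act} : {n : ℕ} → M.FinPath n → S
  | 0, h => h.1
  | n + 1, h => (h.2 (Fin.last n)).2.2

/-- The `k`-th state `s_k` of a path. -/
def Path.state {M : MarkovAutomaton S Act} (π : M.Path) : ℕ → S
  | 0 => π.1
  | k + 1 => (π.2 k).2.2

/-- The time `t_0 + ⋯ + t_{k-1}` at which the `k`-th state of a path is entered. -/
def Path.arrival {M : MarkovAutomaton S Act} (π : M.Path) (k : ℕ) : ℝ≥0 :=
  ∑ i ∈ Finset.range k, (π.2 i).2.1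

/-- The set of states in `π@t`, that is, those occupied at time `t`. -/
def Path.at {M : MarkovAutomaton S Act} (π : M.Path) (t : ℝ≥0) : Set S :=
  {s | ∃ k, π.state k = s ∧ π.arrival k ≤ t ∧ t ≤ π.arrival (k + 1)}

/-- The elapsed time `V_G` before first visiting `G` (`∞` if `G` is never visited). -/
def V (M : MarkovAutomaton S Act) (G : Set S) (π : M.Path) : ℝ≥0∞ :=
  ⨅ t ∈ {t : ℝ≥0 | (G ∩ π.at t).Nonempty}, (t : ℝ≥0∞)

/-! ### Policies and their path measures -/

/-- A general measurable policy: measurably in the finite path (states, labels and timing), it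
yields a probability distribution over the probabilistic transitions that are enabled in the last
state, whenever there are any. -/
structure Policy (M : MarkovAutomaton S Act) [MeasurableSpace S] where
  choice : ∀ n, M.FinPath n → M.Trans → ℝ≥0
  measurable_choice : ∀ n tr, Measurable (fun h => choice n h tr)
  choice_eq_zero : ∀ n h tr, tr ∉ M.enabled (FinPath.last h) → choice n h tr = 0
  sum_choice : ∀ n h, FinPath.last h ∈ M.PS → ∑ tr, choice n h tr = 1

variable [MeasurableSpace S]

open Classical in
/-- The law of the next step out of state `s`. In a probabilistic state, a transition is chosen
with the weights `w`, no time elapses, and the next state is drawn from its distribution; in a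
Markovian state, the residence time is exponential with rate `E(s)` and, independently, the next
state is drawn from `P(s, ·)`. -/
def stepMeasure (M : MarkovAutomaton S Act) (s : S) (w : M.Trans → ℝ≥0) : Measure M.Step :=
  if s ∈ M.PS then
    ∑ tr : M.Trans, (w tr : ℝ≥0∞) • ∑ s' : S,
      tr.dist s' • Measure.dirac ((some tr, 0, s') : M.Step)
  else
    ∑ s' : S, (M.P s s' : ℝ≥0∞) •
      (expMeasure (M.E s)).map (fun t : ℝ => ((none, t.toNNReal, s') : M.Step))

lemma measurable_stepMeasure (M : MarkovAutomaton S Act) (s : S) :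
    Measurable (M.stepMeasure s) := by
  classical
  unfold stepMeasure
  split_ifs
  · refine Measure.measurable_of_measurable_coe _ fun B _ => ?_
    simp only [Measure.coe_finsetSum, Finset.sum_apply, Measure.coe_smul, Pi.smul_apply,
      smul_eq_mul]
    fun_prop
  · exact measurable_const

lemma isProbabilityMeasure_stepMeasure (M : MarkovAutomaton S Act) (hM : M.DeadlockFree) (s : S)
    (w : M.Trans → ℝ≥0) (hw : s ∈ M.PS → ∑ tr, w tr = 1) :
    IsProbabilityMeasure (M.stepMeasure s w) := by
  classical
  constructor
  unfold stepMeasure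
  split_ifs with hs
  · have h (tr : M.Trans) : ∑ s', tr.dist s' = 1 := by
      rw [← tsum_fintype (L := .unconditional _)]; exact tr.dist.tsum_coe
    simp only [Measure.coe_finsetSum, Finset.sum_apply, Measure.coe_smul, Pi.smul_apply,
      smul_eq_mul, measure_univ, mul_one, h]
    exact_mod_cast hw hs
  · have hE := M.E_pos ((hM s).resolve_left hs)
    have := isProbabilityMeasure_expMeasure (r := M.E s) (by exact_mod_cast hE)
    have h (s' : S) : IsProbabilityMeasure ((expMeasure (M.E s)).map
        (fun t : ℝ => ((none, t.toNNReal, s') : M.Step))) :=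
      Measure.isProbabilityMeasure_map (by fun_prop)
    simp only [Measure.coe_finsetSum, Finset.sum_apply, Measure.coe_smul, Pi.smul_apply,
      smul_eq_mul, measure_univ, mul_one]
    have h1 : ∑ s', M.P s s' = 1 := by
      simp only [P, ← Finset.sum_div]
      exact div_self hE.ne'
    exact_mod_cast h1

lemma FinPath.measurable_last [DiscreteMeasurableSpace S] (M : MarkovAutomaton S Act) (n : ℕ) :
    Measurable (FinPath.last : M.FinPath n → S) := by
  cases n with
  | zero => exact measurable_fst
  | succ n =>
    change Measurable fun h : M.FinPath (n + 1) => (h.2 (Fin.last n)).2.2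
    fun_prop

/-- The finite path that starts in `s` and has the steps with indices `0, …, n`. -/
def toFinPath (M : MarkovAutomaton S Act) (s : S) (n : ℕ)
    (h : (i : Finset.Iic n) → M.Step) : M.FinPath (n + 1) :=
  (s, fun i => h ⟨i, by simpa using Nat.lt_succ_iff.mp i.2⟩)

/-- The law of step `n + 1` given the steps `0, …, n`, for the policy `D` and the first
state `s`. -/
def Policy.stepKernel [DiscreteMeasurableSpace S] {M : MarkovAutomaton S Act} (D : M.Policy)
    (s : S) (n : ℕ) : Kernel ((i : Finset.Iic n) → M.Step) M.Step where
  toFun h := M.stepMeasure (FinPath.last (M.toFinPath s n h))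
    (D.choice (n + 1) (M.toFinPath s n h))
  measurable' := by
    have h1 : Measurable (M.toFinPath s n) := by unfold toFinPath; fun_prop
    have h2 : Measurable fun x : S × (M.Trans → ℝ≥0) => M.stepMeasure x.1 x.2 :=
      measurable_from_prod_countable_right fun s => M.measurable_stepMeasure s
    have h3 : Measurable (D.choice (n + 1)) :=
      measurable_pi_lambda _ fun tr => D.measurable_choice (n + 1) tr
    exact h2.comp (((FinPath.measurable_last M (n + 1)).comp h1).prodMk (h3.comp h1))

lemma Policy.isMarkovKernel_stepKernel [DiscreteMeasurableSpace S] {M : MarkovAutomaton S Act}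
    (hM : M.DeadlockFree) (D : M.Policy) (s : S) (n : ℕ) : IsMarkovKernel (D.stepKernel s n) :=
  ⟨fun _ => M.isProbabilityMeasure_stepMeasure hM _ _ (D.sum_choice _ _)⟩

/-- The law of the first step for the policy `D` and the first state `s`. -/
def Policy.firstStep {M : MarkovAutomaton S Act} (D : M.Policy) (s : S) : Measure M.Step :=
  M.stepMeasure s (D.choice 0 (s, Fin.elim0))

/-- The probability measure `Pr_{s,D}` on infinite paths: the path starts in `s`, its first step
has law `D.firstStep s`, and every later step is drawn from `D.stepKernel s` given the past
(Ionescu-Tulcea construction). -/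
def pathMeasure [DiscreteMeasurableSpace S] (M : MarkovAutomaton S Act) (hM : M.DeadlockFree)
    (D : M.Policy) (s : S) : Measure M.Path :=
  haveI := D.isMarkovKernel_stepKernel hM s
  (((D.firstStep s).map (fun x => fun _ : Finset.Iic 0 => x)).bind
    (Kernel.traj (X := fun _ => M.Step) (D.stepKernel s) 0)).map (fun ω => (s, ω))

/-- The minimal expected time `eT^min(s, ◇G)` to reach `G` from `s`, over all general measurable
policies. -/
def eTmin [DiscreteMeasurableSpace S] (M : MarkovAutomaton S Act) (hM : M.DeadlockFree)
    (G : Set S) (s : S) : ℝ≥0∞ :=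
  ⨅ D : M.Policy, ∫⁻ π, M.V G π ∂(M.pathMeasure hM D s)

end MarkovAutomaton

open Classical in
/-- The Bellman operator `L`. Its last case is the one of Markovian non-goal states; the minimum
ranges over the probabilistic transitions `(s, α, μ)` enabled in `s`. -/
def MarkovAutomaton.bellman {S Act : Type*} [Fintype S] (M : MarkovAutomaton S Act) (G : Set S)
    (v : S → ℝ≥0∞) (s : S) : ℝ≥0∞ :=
  if s ∈ G then 0
  else if h : (M.enabled s).Nonempty then
    (M.enabled s).inf' h (fun tr => ∑ s', tr.dist s' * v s')
  else 1 / (M.E s : ℝ≥0∞) + ∑ s', (M.P s s' : ℝ≥0∞) * v s'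

end

/-! Condition on the first step. From `s ∉ G`, the time `V` is the first residence time plus `V` of
the tail (`V_of_notMem`). Given the first step `x`, the tail is distributed as a path from the
entered state under any policy that does after `p` what `D` does after `x` followed by `p`
(`map_shift_traj_stepKernel`); this rests on uniqueness of a law on sequences with given initial law
and step kernels. Hence the expected time is the integral, over the first step, of residence time
plus expected time of the continuation (`expectedTime_of_notMem`).

For `L(eTmin) ≤ eTmin`, each continuation is itself a policy, so it costs at least `eTmin`, and
averaging over the first choice cannot beat the minimum. Conversely, a minimizing transition
followed by an `ε`-optimal policy for the entered state costs at most `L(eTmin) + ε`. Only the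
entered state selects the policy, so no measurable selection is needed. -/

section Trajectories

/-! ### Uniqueness and shift of laws on sequences. -/

variable {X : Type*} [MeasurableSpace X]

open Preorder in
/-- Finite measures on sequences are determined by their initial marginals. -/
lemma MeasureTheory.Measure.ext_of_map_frestrictLe {μ ν : Measure (ℕ → X)} [IsFiniteMeasure ν]
    (h : ∀ n, μ.map (frestrictLe (π := fun _ => X) n) = ν.map (frestrictLe n)) : μ = ν := by
  have hν : IsProjectiveLimit ν (fun I => ν.map I.restrict) := fun I => rfl
  refine IsProjectiveLimit.unique (P := fun I : Finset ℕ => ν.map I.restrict) (fun I => ?_) hν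
  have hI := I.subset_Iic_sup_id
  change μ.map I.restrict = ν.map I.restrict
  rw [← Finset.restrict₂_comp_restrict hI,
    ← Measure.map_map (Finset.measurable_restrict₂ hI) (Finset.measurable_restrict _),
    ← Measure.map_map (Finset.measurable_restrict₂ hI) (Finset.measurable_restrict _)]
  exact congrArg _ (h _)

open Preorder in
/-- Finite measures on sequences with the same initial law and the same step kernels are equal. -/
lemma MeasureTheory.Measure.ext_of_step_kernels
    {κ : (n : ℕ) → Kernel ((i : Finset.Iic n) → X) X}
    {μ ν : Measure (ℕ → X)} [IsFiniteMeasure ν]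
    (h0 : μ.map (fun ω => ω 0) = ν.map (fun ω => ω 0))
    (hμ : ∀ n, μ.map (frestrictLe n) ⊗ₘ κ n = μ.map (fun ω => (frestrictLe n ω, ω (n + 1))))
    (hν : ∀ n, ν.map (frestrictLe n) ⊗ₘ κ n = ν.map (fun ω => (frestrictLe n ω, ω (n + 1)))) :
    μ = ν := by
  refine Measure.ext_of_map_frestrictLe fun n => ?_
  induction n with
  | zero =>
    have hg : (frestrictLe (π := fun _ => X) 0) =
        (fun x : X => fun _ : Finset.Iic 0 => x) ∘ (fun ω : ℕ → X => ω 0) := by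
      funext ω ⟨i, hi⟩
      obtain rfl : i = 0 := by simpa using hi
      rfl
    rw [hg, ← Measure.map_map (by fun_prop) (by fun_prop),
      ← Measure.map_map (by fun_prop) (by fun_prop), h0]
  | succ n ih =>
    -- `g` appends the new coordinate, so the law of the first `n + 2` coordinates is the image of a
    -- measure that the law of the first `n + 1` and `κ n` determine.
    let g : ((i : Finset.Iic n) → X) × X → ((i : Finset.Iic (n + 1)) → X) :=
      fun p i => if hi : i.1 ≤ n then p.1 ⟨i, Finset.mem_Iic.2 hi⟩ else p.2
    have hgm : Measurable g := by
      refine measurable_pi_lambda _ fun i => ?_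
      by_cases hi : i.1 ≤ n
      · simp only [g, hi, dif_pos]; fun_prop
      · simp only [g, hi, dif_neg, not_false_eq_true]; fun_prop
    have hg : (frestrictLe (π := fun _ => X) (n + 1)) =
        g ∘ (fun ω : ℕ → X => (frestrictLe (π := fun _ => X) n ω, ω (n + 1))) := by
      funext ω ⟨i, hi⟩
      by_cases hin : i ≤ n
      · simp [g, hin]
      · obtain rfl : i = n + 1 := by rw [Finset.mem_Iic] at hi; omega
        simp [g]
    rw [hg, ← Measure.map_map hgm (by fun_prop), ← Measure.map_map hgm (by fun_prop), ← hμ, ← hν,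
      ih]

open Preorder in
lemma ProbabilityTheory.Kernel.ae_traj_zero_eq [MeasurableSingletonClass X]
    (κ : (n : ℕ) → Kernel ((i : Finset.Iic n) → X) X) [∀ n, IsMarkovKernel (κ n)] (x : X) :
    ∀ᵐ ω ∂(Kernel.traj (X := fun _ => X) κ 0 (fun _ => x)), ω 0 = x := by
  have h1 : ∀ᵐ h ∂((Kernel.traj (X := fun _ => X) κ 0 (fun _ => x)).map (frestrictLe 0)),
      h ⟨0, by simp⟩ = x := by
    rw [Kernel.traj_map_frestrictLe_apply, Kernel.partialTraj_self, Kernel.id_apply, ae_dirac_iff]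
    exact measurable_pi_apply (X := fun _ : Finset.Iic 0 => X) _ (measurableSet_singleton x)
  exact ae_of_ae_map (by fun_prop) h1

lemma ProbabilityTheory.Kernel.map_zero_bind_traj [MeasurableSingletonClass X]
    (κ : (n : ℕ) → Kernel ((i : Finset.Iic n) → X) X) [∀ n, IsMarkovKernel (κ n)]
    (μ : Measure X) :
    ((μ.map (fun y => fun _ : Finset.Iic 0 => y)).bind
      (Kernel.traj (X := fun _ => X) κ 0)).map (fun ω => ω 0) = μ := by
  refine Measure.ext_of_lintegral _ fun f hf => ?_
  have hf0 : Measurable fun ω : ℕ → X => f (ω 0) := by fun_prop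
  rw [MeasureTheory.lintegral_map hf (by fun_prop),
    Measure.lintegral_bind (by fun_prop) hf0.aemeasurable,
    MeasureTheory.lintegral_map (Measurable.lintegral_kernel (by fun_prop)) (by fun_prop)]
  refine lintegral_congr fun x => ?_
  rw [lintegral_congr_ae (g := fun _ => f x)]
  · simp
  · filter_upwards [Kernel.ae_traj_zero_eq κ x] with ω hω
    rw [hω]

open Preorder in
/-- After a deterministic first step `x`, the shifted trajectory follows the shifted kernels. -/
lemma ProbabilityTheory.Kernel.map_shift_traj [MeasurableSingletonClass X]
    (κ κ' : (n : ℕ) → Kernel ((i : Finset.Iic n) → X) X)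
    [∀ n, IsMarkovKernel (κ n)] [∀ n, IsMarkovKernel (κ' n)] (x : X)
    (hκ : ∀ n (ω : ℕ → X), ω 0 = x →
      κ (n + 1) (frestrictLe (n + 1) ω) = κ' n (frestrictLe n fun i => ω (i + 1))) :
    (Kernel.traj (X := fun _ => X) κ 0 (fun _ => x)).map (fun ω i => ω (i + 1)) =
      ((κ 0 (fun _ => x)).map (fun y => fun _ : Finset.Iic 0 => y)).bind
        (Kernel.traj (X := fun _ => X) κ' 0) := by
  have hb : ((κ 0 (fun _ => x)).map (fun y => fun _ : Finset.Iic 0 => y)).bind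
        (Kernel.traj (X := fun _ => X) κ' 0) =
      Kernel.trajMeasure (X := fun _ => X) (κ 0 (fun _ => x)) κ' := rfl
  have hstep (n : ℕ) : (Kernel.traj (X := fun _ => X) κ 0 (fun _ => x)).map (frestrictLe n) ⊗ₘ κ n =
      (Kernel.traj (X := fun _ => X) κ 0 (fun _ => x)).map
        (fun ω => (frestrictLe n ω, ω (n + 1))) := by
    rw [Kernel.traj_map_frestrictLe_apply, Kernel.partialTraj_compProd_eq_map_traj (Nat.zero_le n)]
  have hx := Kernel.ae_traj_zero_eq κ x
  have hsh : Measurable (fun (ω : ℕ → X) i => ω (i + 1)) := by fun_prop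
  rw [hb]
  have := Measure.isProbabilityMeasure_map
    (μ := Kernel.traj (X := fun _ => X) κ 0 (fun _ => x)) hsh.aemeasurable
  refine Measure.ext_of_step_kernels (κ := κ') ?_ (fun n => ?_)
    (fun n => Kernel.map_frestrictLe_trajMeasure_compProd_eq_map_trajMeasure)
  · rw [Measure.map_map (by fun_prop) hsh]
    change (Kernel.traj (X := fun _ => X) κ 0 (fun _ => x)).map (fun ω => ω (0 + 1)) = _
    rw [← Kernel.map_apply _ (by fun_prop), Kernel.map_traj_succ_self, ← hb,
      Kernel.map_zero_bind_traj]
  · refine Measure.ext_of_lintegral _ fun f hf => ?_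
    -- `q` drops coordinate `0`: step `n` of the shifted sequence is step `n + 1` of the original
    -- one, tested against `f (q ·, ·)`.
    let q : ((i : Finset.Iic (n + 1)) → X) → ((i : Finset.Iic n) → X) :=
      fun h i => h ⟨i + 1, by have := i.2; rw [Finset.mem_Iic] at this ⊢; omega⟩
    have hq : Measurable q := by fun_prop
    rw [Measure.lintegral_compProd hf, Measure.map_map (by fun_prop) hsh,
      MeasureTheory.lintegral_map (Measurable.lintegral_kernel_prod_right' (f := f) (κ := κ' n) hf)
        ((measurable_frestrictLe n).comp hsh),
      MeasureTheory.lintegral_map hf (by fun_prop), MeasureTheory.lintegral_map (by fun_prop) hsh]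
    have h1 := congrArg (fun m => ∫⁻ p, f (q p.1, p.2) ∂m) (hstep (n + 1))
    simp only at h1
    rw [Measure.lintegral_compProd (by fun_prop),
      MeasureTheory.lintegral_map (by fun_prop) (by fun_prop),
      MeasureTheory.lintegral_map _ (by fun_prop)] at h1
    · refine Eq.trans (lintegral_congr_ae ?_) h1
      filter_upwards [hx] with ω hω
      simp only [Function.comp_apply]
      rw [← hκ n ω hω]
      rfl
    · fun_prop

end Trajectories

/-- The mean of the exponential distribution. -/
lemma ProbabilityTheory.lintegral_toNNReal_expMeasure {r : ℝ≥0} (hr : 0 < r) :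
    ∫⁻ t : ℝ, (t.toNNReal : ℝ≥0∞) ∂(expMeasure r) = (r : ℝ≥0∞)⁻¹ := by
  have hr' : (0 : ℝ) < r := by exact_mod_cast hr
  have hm : Measurable (gammaPDF 1 r) := (measurable_gammaPDFReal 1 r).ennreal_ofReal
  have hm2 : Measurable (gammaPDF 2 r) := (measurable_gammaPDFReal 2 r).ennreal_ofReal
  rw [expMeasure, gammaMeasure, lintegral_withDensity_eq_lintegral_mul _ hm (by fun_prop)]
  -- Multiplying the exponential density by `t` gives `1 / r` times the Gamma density of shape 2,
  -- whose total mass is 1.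
  have h (t : ℝ) : (gammaPDF 1 r * fun t : ℝ => (t.toNNReal : ℝ≥0∞)) t =
      (r : ℝ≥0∞)⁻¹ * gammaPDF 2 r t := by
    have hrr : (r : ℝ≥0∞)⁻¹ = ENNReal.ofReal (r : ℝ)⁻¹ := by
      rw [ENNReal.ofReal_inv_of_pos hr', ENNReal.ofReal_coe_nnreal]
    rw [hrr, Pi.mul_apply, gammaPDF, gammaPDF, gammaPDFReal, gammaPDFReal]
    split_ifs with ht
    · change _ * ENNReal.ofReal t = _
      rw [← ENNReal.ofReal_mul (by positivity), ← ENNReal.ofReal_mul (by positivity)]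
      congr 1
      have h2 : ((2 : ℝ) - 1) = 1 := by norm_num
      rw [h2]
      simp only [Real.rpow_one, Real.Gamma_one, sub_self, Real.rpow_zero, Real.Gamma_two,
        Real.rpow_two]
      field_simp
    · simp
  simp_rw [h]
  rw [lintegral_const_mul _ hm2, lintegral_gammaPDF_eq_one (by norm_num) hr', mul_one]

/-! ### The hitting time along a path and the cost of one step. -/

namespace MarkovAutomaton

variable {S Act : Type*} [Fintype S] {M : MarkovAutomaton S Act} {G : Set S}

lemma Path.arrival_mono (π : M.Path) : Monotone π.arrival := fun _ _ h =>
  Finset.sum_le_sum_of_subset (Finset.range_mono h)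

/-- Each visit to a state is cheapest at its entry time. The infimum becomes countable, which gives
measurability and the first-step recursion. -/
lemma V_eq_iInf_arrival (G : Set S) (π : M.Path) :
    M.V G π = ⨅ (k : ℕ) (_ : π.state k ∈ G), (π.arrival k : ℝ≥0∞) := by
  refine le_antisymm (le_iInf₂ fun k hk => ?_) (le_iInf₂ ?_)
  · exact iInf₂_le (π.arrival k) ⟨π.state k, hk, k, rfl, le_rfl, π.arrival_mono k.le_succ⟩
  · rintro t ⟨s, hs, k, rfl, hk, -⟩
    exact iInf₂_le_of_le k hs (by exact_mod_cast hk)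

lemma V_of_mem {π : M.Path} (h : π.1 ∈ G) : M.V G π = 0 := by
  rw [V_eq_iInf_arrival]
  exact le_antisymm (iInf₂_le_of_le 0 h (by simp [Path.arrival])) zero_le

lemma Path.state_tail (s : S) (ω : ℕ → M.Step) (k : ℕ) :
    Path.state ((ω 0).2.2, fun i => ω (i + 1)) k = Path.state (s, ω) (k + 1) := by
  cases k <;> rfl

lemma Path.arrival_succ' (s : S) (ω : ℕ → M.Step) (k : ℕ) :
    Path.arrival (s, ω) (k + 1) =
      (ω 0).2.1 + Path.arrival ((ω 0).2.2, fun i => ω (i + 1)) k := by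
  rw [Path.arrival, Finset.sum_range_succ', add_comm]
  rfl

lemma V_of_notMem {s : S} (hs : s ∉ G) (ω : ℕ → M.Step) :
    M.V G (s, ω) = (ω 0).2.1 + M.V G ((ω 0).2.2, fun i => ω (i + 1)) := by
  rw [V_eq_iInf_arrival, V_eq_iInf_arrival, ENNReal.add_iInf, ← inf_iInf_nat_succ]
  -- The index `0` contributes nothing because the path starts outside `G`; the remaining indices
  -- are those of the tail.
  have h0 : (⨅ (_ : Path.state (s, ω) 0 ∈ G), (Path.arrival (s, ω) 0 : ℝ≥0∞)) = ⊤ :=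
    iInf_neg hs
  rw [h0, top_inf_eq]
  refine iInf_congr fun k => ?_
  rw [Path.state_tail s, Path.arrival_succ']
  by_cases hk : Path.state (s, ω) (k + 1) ∈ G
  · simp [hk]
  · simp [hk]

lemma bellman_of_mem_PS {s : S} (hs : s ∉ G) (hp : (M.enabled s).Nonempty) (v : S → ℝ≥0∞) :
    M.bellman G v s = (M.enabled s).inf' hp (fun tr => ∑ s', tr.dist s' * v s') := by
  rw [bellman, if_neg hs, dif_pos hp]

lemma bellman_of_notMem_PS {s : S} (hs : s ∉ G) (hp : s ∉ M.PS) (v : S → ℝ≥0∞) :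
    M.bellman G v s = 1 / (M.E s : ℝ≥0∞) + ∑ s', (M.P s s' : ℝ≥0∞) * v s' := by
  rw [bellman, if_neg hs]
  exact dif_neg hp

variable [MeasurableSpace S]

instance : MeasurableSingletonClass M.Label := ⟨fun _ => trivial⟩

variable [DiscreteMeasurableSpace S]

@[fun_prop]
lemma measurable_V (G : Set S) : Measurable (M.V G) := by
  have h : M.V G = fun π : M.Path => ⨅ (k : ℕ) (_ : π.state k ∈ G), (π.arrival k : ℝ≥0∞) :=
    funext (V_eq_iInf_arrival G)
  rw [h]
  refine Measurable.iInf fun k => ?_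
  have hst : Measurable fun π : M.Path => π.state k := by
    cases k with
    | zero => exact measurable_fst
    | succ k =>
      change Measurable fun π : M.Path => (π.2 k).2.2
      fun_prop
  have har : Measurable fun π : M.Path => (π.arrival k : ℝ≥0∞) := by
    unfold Path.arrival; fun_prop
  classical
  have : (fun π : M.Path => ⨅ (_ : π.state k ∈ G), (π.arrival k : ℝ≥0∞)) =
      fun π : M.Path => if π.state k ∈ G then (π.arrival k : ℝ≥0∞) else ⊤ := by
    funext π; split_ifs with h <;> simp [h]
  rw [this]
  exact Measurable.ite (hst (MeasurableSet.of_discrete (s := G))) har measurable_const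

/-! ### One step -/

lemma lintegral_stepMeasure_of_mem_PS {s : S} (hs : s ∈ M.PS) (w : M.Trans → ℝ≥0)
    (v : S → ℝ≥0∞) :
    ∫⁻ x, (x.2.1 + v x.2.2) ∂(M.stepMeasure s w) =
      ∑ tr, (w tr : ℝ≥0∞) * ∑ s', tr.dist s' * v s' := by
  simp only [stepMeasure, hs, if_true, lintegral_finsetSum_measure, lintegral_smul_measure,
    lintegral_dirac, smul_eq_mul, ENNReal.coe_zero, zero_add]

lemma lintegral_stepMeasure_of_notMem_PS (hM : M.DeadlockFree) {s : S} (hs : s ∉ M.PS)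
    (w : M.Trans → ℝ≥0) (v : S → ℝ≥0∞) :
    ∫⁻ x, (x.2.1 + v x.2.2) ∂(M.stepMeasure s w) =
      1 / (M.E s : ℝ≥0∞) + ∑ s', (M.P s s' : ℝ≥0∞) * v s' := by
  have hE := M.E_pos ((hM s).resolve_left hs)
  have := isProbabilityMeasure_expMeasure (r := M.E s) (by exact_mod_cast hE)
  have h1 : ∑ s', (M.P s s' : ℝ≥0∞) = 1 := by
    have : ∑ s', M.P s s' = 1 := by
      simp only [P, ← Finset.sum_div]
      exact div_self hE.ne'
    exact_mod_cast this
  have h2 (s' : S) : ∫⁻ x, ((x.2.1 : ℝ≥0∞) + v x.2.2) ∂((expMeasure (M.E s)).map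
      (fun t : ℝ => ((none, t.toNNReal, s') : M.Step))) = (M.E s : ℝ≥0∞)⁻¹ + v s' := by
    rw [lintegral_map (by fun_prop) (by fun_prop), lintegral_add_right _ (by fun_prop),
      lintegral_toNNReal_expMeasure hE]
    simp
  simp only [stepMeasure, hs, if_false, lintegral_finsetSum_measure, lintegral_smul_measure, h2,
    smul_eq_mul, mul_add, Finset.sum_add_distrib, ← Finset.sum_mul, h1, one_mul, one_div]

/-- In a probabilistic state, a weighted average over enabled transitions is at least their minimum;
in a Markovian state there is no choice and equality holds. -/
lemma bellman_le_lintegral_stepMeasure (hM : M.DeadlockFree) {s : S} (hs : s ∉ G)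
    {w : M.Trans → ℝ≥0} (h0 : ∀ tr ∉ M.enabled s, w tr = 0) (h1 : s ∈ M.PS → ∑ tr, w tr = 1)
    (v : S → ℝ≥0∞) :
    M.bellman G v s ≤ ∫⁻ x, (x.2.1 + v x.2.2) ∂(M.stepMeasure s w) := by
  by_cases hp : s ∈ M.PS
  · rw [lintegral_stepMeasure_of_mem_PS hp, bellman_of_mem_PS hs hp]
    set m := (M.enabled s).inf' hp (fun tr => ∑ s', tr.dist s' * v s') with hm
    calc m = ∑ tr, (w tr : ℝ≥0∞) * m := by
          rw [← Finset.sum_mul, ← ENNReal.ofNNReal_finsetSum, h1 hp, ENNReal.coe_one, one_mul]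
      _ ≤ _ := Finset.sum_le_sum fun tr _ => ?_
    by_cases htr : tr ∈ M.enabled s
    · gcongr
      exact Finset.inf'_le _ htr
    · simp [h0 tr htr]
  · rw [lintegral_stepMeasure_of_notMem_PS hM hp, bellman_of_notMem_PS hs hp]

/-- Some choice of an enabled transition in every probabilistic state attains the Bellman
operator. -/
lemma exists_weights_bellman (hM : M.DeadlockFree) (G : Set S) (v : S → ℝ≥0∞) :
    ∃ w : S → M.Trans → ℝ≥0, (∀ s, ∀ tr ∉ M.enabled s, w s tr = 0) ∧
      (∀ s ∈ M.PS, ∑ tr, w s tr = 1) ∧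
      ∀ s ∉ G, ∫⁻ x, (x.2.1 + v x.2.2) ∂(M.stepMeasure s (w s)) = M.bellman G v s := by
  classical
  have h (s : S) : ∃ w : M.Trans → ℝ≥0, (∀ tr ∉ M.enabled s, w tr = 0) ∧
      (s ∈ M.PS → ∑ tr, w tr = 1) ∧
      (s ∉ G → ∫⁻ x, (x.2.1 + v x.2.2) ∂(M.stepMeasure s w) = M.bellman G v s) := by
    by_cases hp : s ∈ M.PS
    · obtain ⟨t, ht, hmin⟩ :=
        (M.enabled s).exists_mem_eq_inf' hp (fun tr => ∑ s', tr.dist s' * v s')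
      -- All weight goes to one minimizing transition `t`.
      refine ⟨Pi.single t 1, fun tr htr => ?_, fun _ => by simp, fun hs => ?_⟩
      · exact Pi.single_eq_of_ne (by rintro rfl; exact htr ht) _
      · rw [lintegral_stepMeasure_of_mem_PS hp, bellman_of_mem_PS hs hp, hmin,
          Finset.sum_eq_single t]
        · simp
        · intro tr _ htr
          simp [Pi.single_eq_of_ne htr]
        · simp
    · refine ⟨0, fun _ _ => rfl, fun h => absurd h hp, fun hs => ?_⟩
      rw [lintegral_stepMeasure_of_notMem_PS hM hp, bellman_of_notMem_PS hs hp]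
  choose w hw0 hw1 hw using h
  exact ⟨w, hw0, hw1, hw⟩

end MarkovAutomaton

/-! ### Splicing policies and first-step analysis. -/

namespace MarkovAutomaton

variable {S Act : Type*} [Fintype S] {M : MarkovAutomaton S Act} {G : Set S}

lemma FinPath.last_cons (s : S) (x : M.Step) {n : ℕ} (h : Fin n → M.Step) :
    FinPath.last ((s, Fin.cons x h) : M.FinPath (n + 1)) =
      FinPath.last ((x.2.2, h) : M.FinPath n) := by
  cases n <;> rfl

variable [MeasurableSpace S]

/-- The memoryless policy that chooses transitions in the state `s` with weights `w s`. -/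
noncomputable def Policy.memoryless [DiscreteMeasurableSpace S] (w : S → M.Trans → ℝ≥0)
    (h0 : ∀ s, ∀ tr ∉ M.enabled s, w s tr = 0) (h1 : ∀ s ∈ M.PS, ∑ tr, w s tr = 1) :
    M.Policy where
  choice _ h := w (FinPath.last h)
  measurable_choice n tr :=
    (Measurable.of_discrete (f := fun s => w s tr)).comp (FinPath.measurable_last M n)
  choice_eq_zero _ _ tr htr := h0 _ tr htr
  sum_choice _ _ hs := h1 _ hs

/-- The policy that uses the weights `w` for the first transition, and then forgets the past and
follows the policy `D s'`, where `s'` is the state that the first step enters. -/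
noncomputable def Policy.concat [DiscreteMeasurableSpace S] (w : S → M.Trans → ℝ≥0)
    (h0 : ∀ s, ∀ tr ∉ M.enabled s, w s tr = 0) (h1 : ∀ s ∈ M.PS, ∑ tr, w s tr = 1)
    (D : S → M.Policy) : M.Policy where
  choice
    | 0, h => w h.1
    | n + 1, h => (D (h.2 0).2.2).choice n ((h.2 0).2.2, Fin.tail h.2)
  measurable_choice n tr := by
    cases n with
    | zero => exact (Measurable.of_discrete (f := fun s => w s tr)).comp measurable_fst
    | succ n =>
      have h2 : Measurable fun p : S × M.FinPath n => (D p.1).choice n p.2 tr :=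
        measurable_from_prod_countable_right fun s => (D s).measurable_choice n tr
      have h3 : Measurable fun h : M.FinPath (n + 1) =>
          ((h.2 0).2.2, (((h.2 0).2.2, Fin.tail h.2) : M.FinPath n)) := by
        unfold Fin.tail; fun_prop
      exact h2.comp h3
  choice_eq_zero n h tr htr := by
    cases n with
    | zero => exact h0 _ tr htr
    | succ n =>
      refine (D _).choice_eq_zero n _ tr ?_
      rwa [← FinPath.last_cons h.1, Fin.cons_self_tail]
  sum_choice n h hs := by
    cases n with
    | zero => exact h1 _ hs
    | succ n =>
      refine (D _).sum_choice n _ ?_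
      rwa [← FinPath.last_cons h.1, Fin.cons_self_tail]

open Classical in
/-- The policy that continues `D` after the first step `x` out of the state `s`. (Its values on
finite paths that do not start in the state entered by `x` are irrelevant.) -/
noncomputable def Policy.continuation [DiscreteMeasurableSpace S] (D : M.Policy) (s : S)
    (x : M.Step) : M.Policy where
  choice n h := if h.1 = x.2.2 then D.choice (n + 1) (s, Fin.cons x h.2) else D.choice n h
  measurable_choice n tr := by
    have hc : Measurable fun h : M.FinPath n => ((s, Fin.cons x h.2) : M.FinPath (n + 1)) := by
      refine measurable_const.prodMk (measurable_pi_lambda _ fun i => ?_)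
      cases i using Fin.cases with
      | zero => simp
      | succ i => simp only [Fin.cons_succ]; fun_prop
    have he : (fun h : M.FinPath n =>
        (if h.1 = x.2.2 then D.choice (n + 1) (s, Fin.cons x h.2) else D.choice n h) tr) =
        fun h : M.FinPath n => if h.1 = x.2.2 then
          D.choice (n + 1) (s, Fin.cons x h.2) tr else D.choice n h tr := by
      funext h
      split_ifs <;> rfl
    rw [he]
    exact Measurable.ite (measurable_fst (measurableSet_singleton x.2.2))
      ((D.measurable_choice (n + 1) tr).comp hc) (D.measurable_choice n tr)
  choice_eq_zero n h tr htr := by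
    split_ifs with hx
    · refine D.choice_eq_zero _ _ tr ?_
      rwa [FinPath.last_cons, ← hx]
    · exact D.choice_eq_zero _ _ tr htr
  sum_choice n h hs := by
    split_ifs with hx
    · refine D.sum_choice _ _ ?_
      rwa [FinPath.last_cons, ← hx]
    · exact D.sum_choice _ _ hs

variable [DiscreteMeasurableSpace S]

/-- The expected time to reach `G` from `s` under the policy `D`. -/
noncomputable def expectedTime (hM : M.DeadlockFree) (G : Set S) (D : M.Policy) (s : S) : ℝ≥0∞ :=
  ∫⁻ π, M.V G π ∂(M.pathMeasure hM D s)

lemma expectedTime_eq (hM : M.DeadlockFree) (G : Set S) (D : M.Policy) (s : S) :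
    haveI := D.isMarkovKernel_stepKernel hM s
    expectedTime hM G D s = ∫⁻ ω, M.V G (s, ω)
      ∂(((D.firstStep s).map (fun x => fun _ : Finset.Iic 0 => x)).bind
        (Kernel.traj (X := fun _ => M.Step) (D.stepKernel s) 0)) := by
  rw [expectedTime, pathMeasure, lintegral_map (by fun_prop) (by fun_prop)]

lemma expectedTime_of_mem (hM : M.DeadlockFree) {s : S} (hs : s ∈ G) (D : M.Policy) :
    expectedTime hM G D s = 0 := by
  rw [expectedTime_eq]
  simp [V_of_mem (G := G) (π := (s, _)) hs]

/-- After the first step `x`, the path measure is the one of any policy `D'` that continues `D`. -/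
lemma map_shift_traj_stepKernel (hM : M.DeadlockFree) (D D' : M.Policy) (s : S) (x : M.Step)
    (h : ∀ n (p : Fin n → M.Step),
      D'.choice n (x.2.2, p) = D.choice (n + 1) (s, Fin.cons x p)) :
    haveI := D.isMarkovKernel_stepKernel hM s
    haveI := D'.isMarkovKernel_stepKernel hM x.2.2
    (Kernel.traj (X := fun _ => M.Step) (D.stepKernel s) 0 (fun _ => x)).map
        (fun ω i => ω (i + 1)) =
      ((D'.firstStep x.2.2).map (fun x => fun _ : Finset.Iic 0 => x)).bind
        (Kernel.traj (X := fun _ => M.Step) (D'.stepKernel x.2.2) 0) := by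
  have := D.isMarkovKernel_stepKernel hM s
  have := D'.isMarkovKernel_stepKernel hM x.2.2
  have h0 : D'.firstStep x.2.2 = D.stepKernel s 0 (fun _ => x) := by
    change M.stepMeasure x.2.2 _ = M.stepMeasure x.2.2 _
    congr 1
    rw [h]
    congr 2
    funext i
    fin_cases i
    rfl
  rw [h0]
  refine Kernel.map_shift_traj _ _ x fun n ω hω => ?_
  change M.stepMeasure (ω (n + 1)).2.2 _ = M.stepMeasure (ω (n + 1)).2.2 _
  congr 1
  refine Eq.trans ?_ (h _ _).symm
  refine congrArg _ (Prod.ext rfl (funext fun i => ?_))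
  cases i using Fin.cases with
  | zero => exact hω
  | succ i => rfl

/-- First-step analysis of the expected time. -/
lemma expectedTime_of_notMem (hM : M.DeadlockFree) {s : S} (hs : s ∉ G) (D : M.Policy)
    (D' : M.Step → M.Policy)
    (h : ∀ x n (p : Fin n → M.Step),
      (D' x).choice n (x.2.2, p) = D.choice (n + 1) (s, Fin.cons x p)) :
    expectedTime hM G D s =
      ∫⁻ x, (x.2.1 + expectedTime hM G (D' x) x.2.2) ∂(D.firstStep s) := by
  have := D.isMarkovKernel_stepKernel hM s
  rw [expectedTime_eq, Measure.lintegral_bind (by fun_prop) (by fun_prop),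
    lintegral_map (Measurable.lintegral_kernel (by fun_prop)) (by fun_prop)]
  -- The comparison is pointwise in `x`, so `D'` may depend on `x` without any measurability.
  refine lintegral_congr fun x => ?_
  rw [expectedTime_eq, ← map_shift_traj_stepKernel hM D (D' x) s x (h x),
    lintegral_map (by fun_prop) (by fun_prop)]
  rw [lintegral_congr_ae (g := fun ω => (x.2.1 : ℝ≥0∞) + M.V G (x.2.2, fun i => ω (i + 1))),
    lintegral_add_left (by fun_prop)]
  · simp
  · filter_upwards [Kernel.ae_traj_zero_eq (D.stepKernel s) x] with ω hω
    rw [V_of_notMem hs, hω]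

/-! ### The two inequalities. -/

lemma bellman_eTmin_le (hM : M.DeadlockFree) (G : Set S) (s : S) :
    M.bellman G (M.eTmin hM G) s ≤ M.eTmin hM G s := by
  by_cases hs : s ∈ G
  · simp [bellman, hs]
  refine le_iInf fun D => ?_
  change _ ≤ expectedTime hM G D s
  rw [expectedTime_of_notMem hM hs D (D.continuation s) (fun x n p => if_pos rfl)]
  refine (bellman_le_lintegral_stepMeasure hM hs (fun tr => D.choice_eq_zero 0 (s, Fin.elim0) tr)
    (D.sum_choice 0 (s, Fin.elim0)) _).trans (lintegral_mono fun x => ?_)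
  gcongr
  exact iInf_le _ _

lemma eTmin_le_bellman (hM : M.DeadlockFree) (G : Set S) (s : S) :
    M.eTmin hM G s ≤ M.bellman G (M.eTmin hM G) s := by
  obtain ⟨w, h0, h1, hw⟩ := exists_weights_bellman hM G (M.eTmin hM G)
  by_cases hs : s ∈ G
  · exact (iInf_le _ (Policy.memoryless w h0 h1)).trans
      ((expectedTime_of_mem hM hs _).trans_le zero_le)
  refine ENNReal.le_of_forall_pos_le_add fun ε hε _ => ?_
  have hD (s' : S) : ∃ D : M.Policy, expectedTime hM G D s' ≤ M.eTmin hM G s' + ε := by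
    -- If the infimum is infinite, any policy will do; the memoryless one shows that a policy
    -- exists.
    by_cases ht : M.eTmin hM G s' = ⊤
    · exact ⟨Policy.memoryless w h0 h1, by simp [ht]⟩
    · have hlt := ENNReal.lt_add_right ht (ENNReal.coe_ne_zero.2 hε.ne')
      obtain ⟨D, hD⟩ := iInf_lt_iff.1 hlt
      exact ⟨D, hD.le⟩
  choose D hD using hD
  have := M.isProbabilityMeasure_stepMeasure hM s (w s) (h1 s)
  calc M.eTmin hM G s ≤ expectedTime hM G (Policy.concat w h0 h1 D) s := iInf_le _ _
    _ = ∫⁻ x, (x.2.1 + expectedTime hM G (D x.2.2) x.2.2) ∂(M.stepMeasure s (w s)) :=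
      expectedTime_of_notMem hM hs _ (fun x => D x.2.2) fun x n p => rfl
    _ ≤ ∫⁻ x, ((x.2.1 + M.eTmin hM G x.2.2) + ε) ∂(M.stepMeasure s (w s)) := by
      refine lintegral_mono fun x => ?_
      rw [add_assoc]
      gcongr
      exact hD _
    _ = M.bellman G (M.eTmin hM G) s + ε := by
      -- The weights `w s` attain the Bellman value, and `ε` integrates to `ε` against a probability
      -- measure.
      rw [lintegral_add_right _ measurable_const, hw s hs]
      simp

end MarkovAutomaton

theorem theorem1 {S Act : Type*} [Fintype S] [MeasurableSpace S] [DiscreteMeasurableSpace S]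
    (M : MarkovAutomaton S Act) (hM : M.DeadlockFree) (G : Set S) :
    Function.IsFixedPt (M.bellman G) (M.eTmin hM G) :=
  funext fun s => le_antisymm (M.bellman_eTmin_le hM G s) (M.eTmin_le_bellman hM G s)
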